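/- **Fundamental Lemma of Classical Mechanics.** Let $M$ be a finite-dimensional smooth manifold with a non-degenerate metric $T_2$ of arbitrary signature, i.e. a smooth symmetric 2-covariant tensor field such that $T_2(v,\cdot)\neq 0$ for every tangent vector $v\ne 0$. Let $\pi\colon TM\to M$ be the tangent bundle. A *second order differential equation* on $M$ is a smooth vector field $D$ on $TM$ with $\pi_*(D_v)=v$ for all $v\in TM$. A *horizontal 1-form* is a smooth 1-form $\alpha$ on $TM$ that vanishes on all vertical vectors, i.e. on all $V\in T(TM)$ with $\pi_*V=0$. Let $\theta$ be the Liouville form of $T^*M$ transported to $TM$ by the isomorphism $TM\simeq T^*M$ that $T_2$ defines, that is, $\theta_v(Y)=T_2(v,\pi_*Y)$ for $v\in TM$ and $Y\in T_v(TM)$; let $\omega_2=d\theta$ be the corresponding symplectic form on $TM$, and let $T(v)=\tfrac12T_2(v,v)$ be the kinetic energy. 1. The equation $$D\,\lrcorner\,\omega_2+dT+\alpha=0 \tag{1}$$ establishes a one-to-one correspondence between second order differential equations $D$ on $M$ and horizontal 1-forms $\alpha$ on $TM$: for each second order differential equation $D$ there is exactly one horizontal 1-form $\alpha$ satisfying (1),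 and for each horizontal 1-form $\alpha$ there is exactly one second order differential equation $D$ satisfying (1). 2. Let $D$ and $\alpha$ correspond to each other by (1). A smooth vector field $u$ on $M$ is an *intermediate integral* of $D$ if, regarding $u$ as a section $u\colon M\to TM$, the field $D$ is tangent to $u(M)$, i.e. $D_{u(x)}\in u_*(T_xM)$ for all $x\in M$. This holds if and only if $$u\,\lrcorner\, d(u\,\lrcorner\, T_2)+d(T(u))+u^*\alpha=0,$$ where $T(u)=T\circ u$ and $u^*\alpha$ is the pull-back of $\alpha$ by the section $u\colon M\to TM$. -/

import Mathlib

open Set Bundle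
open scoped Manifold ContDiff Topology

namespace ClassicalMechanics

noncomputable section

/-! ### Vector fields and differential forms on a manifold -/

section Forms

variable {E : Type*} [NormedAddCommGroup E] [NormedSpace ℝ E]
  {H : Type*} [TopologicalSpace H] (I : ModelWithCorners ℝ E H)
  {N : Type*} [TopologicalSpace N] [ChartedSpace H N]

/-- A vector field `X` on the manifold `N` is smooth, as a section of the tangent bundle. -/
def SmoothVectorField [IsManifold I 1 N] (X : Π p : N, TangentSpace I p) : Prop :=
  ContMDiff I I.tangent ∞ (fun p : N => (⟨p, X p⟩ : TangentBundle I N))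

/-- A 1-form `α` on the manifold `N` is smooth, as a section of the cotangent bundle. -/
def SmoothOneForm [IsManifold I 1 N] (α : Π p : N, TangentSpace I p →L[ℝ] ℝ) : Prop :=
  ContMDiff I (I.prod 𝓘(ℝ, E →L[ℝ] ℝ)) ∞
    (fun p : N => TotalSpace.mk' (E →L[ℝ] ℝ)
      (E := fun p : N => TangentSpace I p →L[ℝ] Bundle.Trivial N ℝ p) p (α p))

/-- The expression of the 1-form `α` in the preferred chart at `p`, that is, the pullback of `α`
under the inverse of the chart; it is a 1-form on the model vector space `E`. -/
def oneFormInChart (α : Π q : N, TangentSpace I q →L[ℝ] ℝ) (p : N) (y : E) : E →L[ℝ] ℝ :=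
  (α ((extChartAt I p).symm y)).comp
    (mfderivWithin 𝓘(ℝ, E) I (extChartAt I p).symm (range I) y)

/-- The exterior derivative `dα` of a 1-form `α` on a manifold: at the point `p`, it is the
pullback under the preferred chart at `p` of the exterior derivative of the expression of `α` in
that chart. The convention is `dα(X, Y) = X(α(Y)) - Y(α(X)) - α([X, Y])`. -/
def extDerivOneForm (α : Π q : N, TangentSpace I q →L[ℝ] ℝ) (p : N) :
    (TangentSpace I p) [⋀^Fin 2]→L[ℝ] ℝ :=
  (extDerivWithin
      (fun y : E => ContinuousAlternatingMap.ofSubsingleton ℝ E ℝ (0 : Fin 1)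
        (oneFormInChart I α p y))
      (range I) (extChartAt I p p)).compContinuousLinearMap
    (mfderiv I 𝓘(ℝ, E) (extChartAt I p) p)

/-- The differential `df` of a function `f : N → ℝ`. -/
def differential (f : N → ℝ) (p : N) : TangentSpace I p →L[ℝ] ℝ :=
  mfderiv I 𝓘(ℝ, ℝ) f p

/-- A non-degenerate metric `T₂` of arbitrary signature on `N`: a smooth symmetric 2-covariant
tensor field without kernel. -/
structure NondegenerateMetric (N : Type*) [TopologicalSpace N] [ChartedSpace H N]
    [IsManifold I 1 N] where
  /-- the bilinear form on each tangent space -/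
  toFun (x : N) : TangentSpace I x →L[ℝ] TangentSpace I x →L[ℝ] ℝ
  symm (x : N) (v w : TangentSpace I x) : toFun x v w = toFun x w v
  nondegenerate (x : N) (v : TangentSpace I x) (hv : ∀ w, toFun x v w = 0) : v = 0
  contMDiff : ContMDiff I (I.prod 𝓘(ℝ, E →L[ℝ] E →L[ℝ] ℝ)) ∞
    (fun x : N => TotalSpace.mk' (E →L[ℝ] E →L[ℝ] ℝ)
      (E := fun x : N => TangentSpace I x →L[ℝ] TangentSpace I x →L[ℝ] Bundle.Trivial N ℝ x)
      x (toFun x))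

end Forms

/-! ### The geometry of the tangent bundle -/

section Tangent

variable {E : Type*} [NormedAddCommGroup E] [NormedSpace ℝ E]
  {H : Type*} [TopologicalSpace H] (I : ModelWithCorners ℝ E H)
  {M : Type*} [TopologicalSpace M] [ChartedSpace H M] [IsManifold I 1 M]

/-- The tangent map `π_* : T_v(TM) → T_{π(v)} M` of the canonical projection `π : TM → M`. -/
def projTangentMap (v : TangentBundle I M) :
    TangentSpace I.tangent v →L[ℝ] TangentSpace I v.proj :=
  mfderiv I.tangent I (fun w : TangentBundle I M => w.proj) v

/-- A smooth 1-form on `TM` is horizontal if it annihilates the vertical tangent vectors, those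
tangent to the fibres of `π : TM → M`. -/
def IsHorizontalForm [IsManifold I.tangent 1 (TangentBundle I M)]
    (α : Π v : TangentBundle I M, TangentSpace I.tangent v →L[ℝ] ℝ) : Prop :=
  SmoothOneForm I.tangent α ∧
    ∀ (v : TangentBundle I M) (V : TangentSpace I.tangent v),
      projTangentMap I v V = 0 → α v V = 0

/-- A second order differential equation on `M`: a smooth vector field `D` on `TM` whose value at
each `v` is an acceleration, `π_* (D v) = v`. -/
def IsSecondOrderEquation [IsManifold I.tangent 1 (TangentBundle I M)]
    (D : Π v : TangentBundle I M, TangentSpace I.tangent v) : Prop :=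
  SmoothVectorField I.tangent D ∧
    ∀ v : TangentBundle I M, projTangentMap I v (D v) = v.snd

/-- The vector field `u` seen as a section `M → TM`. -/
def fieldSection (u : Π x : M, TangentSpace I x) (x : M) : TangentBundle I M := ⟨x, u x⟩

/-- The tangent map `u_* : T_x M → T_{u(x)}(TM)` of the section `u : M → TM`. -/
def fieldTangentMap (u : Π x : M, TangentSpace I x) (x : M) :
    TangentSpace I x →L[ℝ] TangentSpace I.tangent (fieldSection I u x) :=
  mfderiv I I.tangent (fieldSection I u) x

/-- The smooth vector field `u` on `M` is an intermediate integral of the vector field `D` on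
`TM`: `D` is tangent to the submanifold `u(M)` of `TM` at each point of it. -/
def IsIntermediateIntegral
    (D : Π v : TangentBundle I M, TangentSpace I.tangent v) (u : Π x : M, TangentSpace I x) :
    Prop :=
  ∀ x : M, D (fieldSection I u x) ∈ range (fieldTangentMap I u x)

variable {I}

/-- The Liouville form of `T*M` transported to `TM` by the metric:
`θ_v = v ⌟ T₂`, pulled back from `M` to `TM`. -/
def NondegenerateMetric.liouvilleForm (g : NondegenerateMetric I M) (v : TangentBundle I M) :
    TangentSpace I.tangent v →L[ℝ] ℝ :=
  (g.toFun v.proj v.snd).comp (projTangentMap I v)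

/-- The symplectic form `ω₂ = dθ` on `TM`. -/
def NondegenerateMetric.symplecticForm (g : NondegenerateMetric I M) (v : TangentBundle I M) :
    (TangentSpace I.tangent v) [⋀^Fin 2]→L[ℝ] ℝ :=
  extDerivOneForm I.tangent g.liouvilleForm v

/-- The kinetic energy `T(v) = T₂(v, v) / 2`. -/
def NondegenerateMetric.kineticEnergy (g : NondegenerateMetric I M) (v : TangentBundle I M) : ℝ :=
  (1 / 2) * g.toFun v.proj v.snd v.snd

/-- The Newton equation `D ⌟ ω₂ + dT + α = 0`, an equality of 1-forms on `TM`. -/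
def NewtonEquation (g : NondegenerateMetric I M)
    (D : Π v : TangentBundle I M, TangentSpace I.tangent v)
    (α : Π v : TangentBundle I M, TangentSpace I.tangent v →L[ℝ] ℝ) : Prop :=
  ∀ (v : TangentBundle I M) (Y : TangentSpace I.tangent v),
    g.symplecticForm v ![D v, Y]
      + differential I.tangent g.kineticEnergy v Y + α v Y = 0

/-- The equation `u ⌟ d(u ⌟ T₂) + d(T(u)) + u^* α = 0`, an equality of 1-forms on `M`. -/
def IntermediateNewtonEquation (g : NondegenerateMetric I M)
    (α : Π v : TangentBundle I M, TangentSpace I.tangent v →L[ℝ] ℝ)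
    (u : Π x : M, TangentSpace I x) : Prop :=
  ∀ (x : M) (Y : TangentSpace I x),
    extDerivOneForm I (fun x' : M => g.toFun x' (u x')) x ![u x, Y]
      + differential I (fun x' : M => g.kineticEnergy (fieldSection I u x')) x Y
      + α (fieldSection I u x) (fieldTangentMap I u x Y) = 0

end Tangent

end

end ClassicalMechanics

/-!
Everything rests on two facts. First, the exterior derivative commutes with pullback, which makes
`dα` computable in every chart and along every section. Second, evaluating on the vertical lift of
`w ∈ T_x M` to `v ∈ T_x M` gives `ω₂(X, lift w) = -T₂(w, π_* X)` and `dT(lift w) = T₂(v, w)`.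

The fibres of `TM` are therefore Lagrangian and `ω₂` pairs the vertical space with `T_x M` as `T₂`
does, so `X ↦ X ⌟ ω₂` is bijective because `T₂` is. Moreover
`(D ⌟ ω₂ + dT)(lift w) = T₂(w, v - π_* D)`, so the form `α` defined by the Newton equation is
horizontal exactly when `π_* D = v`, which gives the correspondence in both directions.

For the intermediate integrals, `d(u ⌟ T₂) = u^* ω₂` because `u ⌟ T₂ = u^* θ`. Subtracting the
pullback of the Newton equation along `u`, the equation for `u` says that `u_* u - D` is
`ω₂`-orthogonal to `T(u(M))`. This vector is vertical, and `ω₂` pairs vertical vectors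
nondegenerately with `T(u(M))`, so it vanishes.
-/

namespace ClassicalMechanics

noncomputable section

/-! ### The exterior derivative of a 1-form -/

section ExteriorDerivative

theorem contDiff_flip {E F G : Type*} [NormedAddCommGroup E] [NormedSpace ℝ E]
    [NormedAddCommGroup F] [NormedSpace ℝ F] [NormedAddCommGroup G] [NormedSpace ℝ G]
    {n : ℕ∞ω} : ContDiff ℝ n (fun B : E →L[ℝ] F →L[ℝ] G => B.flip) :=
  (IsLinearMap.with_bound ⟨fun _ _ => rfl, fun _ _ => rfl⟩ 1 fun B => by
    rw [B.opNorm_flip, one_mul]).contDiff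

variable {E : Type*} [NormedAddCommGroup E] [NormedSpace ℝ E] {β : E → E →L[ℝ] ℝ} {y : E}

/-- The exterior derivative of a 1-form `β` on a normed space, as a bilinear form. -/
def extDerivBilin (β : E → E →L[ℝ] ℝ) (y : E) : E →L[ℝ] E →L[ℝ] ℝ :=
  fderiv ℝ β y - (fderiv ℝ β y).flip

theorem extDerivBilin_apply (β : E → E →L[ℝ] ℝ) (y ξ η : E) :
    extDerivBilin β y ξ η = fderiv ℝ β y ξ η - fderiv ℝ β y η ξ := rfl

theorem contDiffOn_extDerivBilin {s : Set E} (hβ : ContDiffOn ℝ ∞ β s) (hs : IsOpen s) :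
    ContDiffOn ℝ ∞ (extDerivBilin β) s :=
  have h := hβ.fderiv_of_isOpen (m := ∞) hs (by simp)
  h.sub (contDiff_flip.comp_contDiffOn h)

theorem differentiableAt_ofSubsingleton (hβ : DifferentiableAt ℝ β y) :
    DifferentiableAt ℝ
      (fun z => ContinuousAlternatingMap.ofSubsingleton ℝ E ℝ (0 : Fin 1) (β z)) y :=
  (ContinuousAlternatingMap.ofSubsingletonLIE (𝕜 := ℝ) (E := E) (F := ℝ)
    (0 : Fin 1)).differentiable.differentiableAt.comp y hβ

theorem fderiv_apply_const (hβ : DifferentiableAt ℝ β y) (ξ η : E) :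
    fderiv ℝ (fun z => β z η) y ξ = fderiv ℝ β y ξ η := by
  simp [fderiv_clm_apply hβ (differentiableAt_const η)]

theorem extDeriv_ofSubsingleton_apply (hβ : DifferentiableAt ℝ β y) (ξ η : E) :
    extDeriv (fun z => ContinuousAlternatingMap.ofSubsingleton ℝ E ℝ (0 : Fin 1) (β z)) y ![ξ, η] =
      extDerivBilin β y ξ η := by
  have hconst : ∀ c : E, fderiv ℝ (fun z => β z c) y = (fderiv ℝ β y).flip c :=
    fun c => ContinuousLinearMap.ext fun ξ => fderiv_apply_const hβ ξ c
  rw [extDeriv_apply (differentiableAt_ofSubsingleton hβ)]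
  simp [Fin.sum_univ_two, Fin.removeNth, hconst, extDerivBilin_apply, sub_eq_add_neg]

theorem extDerivBilin_pullback {E' : Type*} [NormedAddCommGroup E'] [NormedSpace ℝ E']
    {τ : E' → E} {z : E'} (hβ : DifferentiableAt ℝ β (τ z)) (hτ : ContDiffAt ℝ 2 τ z)
    (ξ η : E') :
    extDerivBilin (fun w => (β (τ w)).comp (fderiv ℝ τ w)) z ξ η =
      extDerivBilin β (τ z) (fderiv ℝ τ z ξ) (fderiv ℝ τ z η) := by
  have hdτ : DifferentiableAt ℝ (fderiv ℝ τ) z :=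
    (hτ.fderiv_right (m := 1) (by norm_num)).differentiableAt (by norm_num)
  have hβτ : DifferentiableAt ℝ (fun w => β (τ w)) z :=
    hβ.comp z (hτ.differentiableAt (by norm_num))
  rw [← extDeriv_ofSubsingleton_apply (hβτ.clm_comp hdτ), ← extDeriv_ofSubsingleton_apply hβ]
  have hvec : fderiv ℝ τ z ∘ ![ξ, η] = ![fderiv ℝ τ z ξ, fderiv ℝ τ z η] := by
    funext i
    fin_cases i <;> rfl
  rw [← hvec]
  exact DFunLike.congr_fun (extDeriv_pullback (differentiableAt_ofSubsingleton hβ) hτ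
    (by rw [minSmoothness_of_isRCLikeNormedField])) ![ξ, η]

end ExteriorDerivative

section Charts

variable {E : Type*} [NormedAddCommGroup E] [NormedSpace ℝ E]
  {H : Type*} [TopologicalSpace H] {I : ModelWithCorners ℝ E H}
  {N : Type*} [TopologicalSpace N] [ChartedSpace H N]
  {F : Type*} [NormedAddCommGroup F] [NormedSpace ℝ F]

variable (I) in
/-- The tangent map of the preferred chart at `p`, at the point `q`. -/
def chartDeriv (p q : N) : TangentSpace I q →L[ℝ] E :=
  mfderiv I 𝓘(ℝ, E) (extChartAt I p) q

variable (I) in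
/-- The tangent map of the inverse of the preferred chart at `p`, at the point `y` of the model
space. -/
def chartDerivSymm (p : N) (y : E) : E →L[ℝ] TangentSpace I ((extChartAt I p).symm y) :=
  mfderivWithin 𝓘(ℝ, E) I (extChartAt I p).symm (range I) y

variable (I) in
/-- The expression of the vector field `X` in the preferred chart at `p`. -/
def vectorFieldInChart (X : Π q : N, TangentSpace I q) (p : N) (y : E) : E :=
  chartDeriv I p ((extChartAt I p).symm y) (X ((extChartAt I p).symm y))

theorem symm_mem_chartAt_source {p : N} {y : E} (hy : y ∈ (extChartAt I p).target) :
    (extChartAt I p).symm y ∈ (chartAt H p).source := by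
  rw [← extChartAt_source I]
  exact (extChartAt I p).map_target hy

section IsManifold

variable [IsManifold I 1 N] {p : N} {y : E}

theorem chartDeriv_chartDerivSymm (hy : y ∈ (extChartAt I p).target) (ξ : E) :
    chartDeriv I p ((extChartAt I p).symm y) (chartDerivSymm I p y ξ) = ξ :=
  DFunLike.congr_fun (mfderiv_extChartAt_comp_mfderivWithin_extChartAt_symm hy) ξ

theorem chartDerivSymm_chartDeriv (hy : y ∈ (extChartAt I p).target)
    (X : TangentSpace I ((extChartAt I p).symm y)) :
    chartDerivSymm I p y (chartDeriv I p ((extChartAt I p).symm y) X) = X :=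
  DFunLike.congr_fun (mfderivWithin_extChartAt_symm_comp_mfderiv_extChartAt hy) X

theorem chartDerivSymm_vectorFieldInChart (X : Π q : N, TangentSpace I q)
    (hy : y ∈ (extChartAt I p).target) :
    chartDerivSymm I p y (vectorFieldInChart I X p y) = X ((extChartAt I p).symm y) :=
  chartDerivSymm_chartDeriv hy _

theorem chartDeriv_self (p : N) (X : TangentSpace I p) : chartDeriv I p p X = X := by
  rw [chartDeriv, mfderiv_extChartAt_self]
  rfl

theorem trivializationAt_eq_chartDeriv {q : N} (hq : q ∈ (chartAt H p).source)
    (X : TangentSpace I q) :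
    (trivializationAt E (TangentSpace I) p ⟨q, X⟩).2 = chartDeriv I p q X := by
  rw [chartDeriv, ← TangentBundle.continuousLinearMapAt_trivializationAt hq,
    Trivialization.continuousLinearMapAt_apply, Trivialization.linearMapAt_apply, if_pos]
  exact hq

theorem symmL_trivializationAt_eq_chartDerivSymm (hy : y ∈ (extChartAt I p).target) (ξ : E) :
    (trivializationAt E (TangentSpace I) p).symmL ℝ ((extChartAt I p).symm y) ξ =
      chartDerivSymm I p y ξ := by
  have hq := symm_mem_chartAt_source hy
  rw [← chartDerivSymm_chartDeriv hy ((trivializationAt E (TangentSpace I) p).symmL ℝ _ ξ),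
    chartDeriv, ← TangentBundle.continuousLinearMapAt_trivializationAt hq]
  exact congrArg _ (Trivialization.continuousLinearMapAt_symmL _ hq ξ)

theorem trivializationAt_oneForm_apply (hy : y ∈ (extChartAt I p).target)
    (a : TangentSpace I ((extChartAt I p).symm y) →L[ℝ] ℝ) (ξ : E) :
    (trivializationAt (E →L[ℝ] ℝ) (fun q : N => TangentSpace I q →L[ℝ] Bundle.Trivial N ℝ q) p
      ⟨(extChartAt I p).symm y, a⟩).2 ξ = a (chartDerivSymm I p y ξ) := by
  rw [← symmL_trivializationAt_eq_chartDerivSymm hy, hom_trivializationAt_apply,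
    ContinuousLinearMap.inCoordinates]
  simp only [Trivial.fiberBundle_trivializationAt', Trivial.continuousLinearMapAt_trivialization,
    ContinuousLinearMap.id_comp]
  rfl

theorem trivializationAt_bilinForm_apply (hy : y ∈ (extChartAt I p).target)
    (b : TangentSpace I ((extChartAt I p).symm y) →L[ℝ]
      TangentSpace I ((extChartAt I p).symm y) →L[ℝ] ℝ) (ξ η : E) :
    (trivializationAt (E →L[ℝ] E →L[ℝ] ℝ)
      (fun q : N => TangentSpace I q →L[ℝ] TangentSpace I q →L[ℝ] Bundle.Trivial N ℝ q) p
      ⟨(extChartAt I p).symm y, b⟩).2 ξ η =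
    b (chartDerivSymm I p y ξ) (chartDerivSymm I p y η) := by
  have hmem : (extChartAt I p).symm y ∈ (trivializationAt (E →L[ℝ] ℝ)
      (fun q : N => TangentSpace I q →L[ℝ] Bundle.Trivial N ℝ q) p).baseSet :=
    ⟨symm_mem_chartAt_source hy, mem_univ _⟩
  rw [← trivializationAt_oneForm_apply hy, ← symmL_trivializationAt_eq_chartDerivSymm hy ξ,
    hom_trivializationAt_apply]
  exact DFunLike.congr_fun (congrFun (Trivialization.coe_linearMapAt_of_mem _ hmem) _) η

end IsManifold

theorem contMDiffOn_chartAt_source_iff {n : ℕ∞ω} [IsManifold I n N] {f : N → F} {p : N} :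
    ContMDiffOn I 𝓘(ℝ, F) n f (chartAt H p).source ↔
      ContDiffOn ℝ n (f ∘ (extChartAt I p).symm) (extChartAt I p).target := by
  rw [← contMDiffOn_iff_contDiffOn]
  refine ⟨fun h => h.comp (contMDiffOn_extChartAt_symm p) fun y hy => symm_mem_chartAt_source hy,
    fun h => ?_⟩
  rw [← extChartAt_source I]
  refine ((h.comp ((contMDiffOn_extChartAt (I := I) (x := p)).mono (extChartAt_source I p).subset)
    fun q hq => (extChartAt I p).map_source hq).congr fun q hq => ?_)
  exact (congrArg f ((extChartAt I p).left_inv hq)).symm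

theorem contMDiff_section_iff_contDiffOn {n : ℕ∞ω} [IsManifold I n N] {V : N → Type*}
    [TopologicalSpace (TotalSpace F V)] [∀ q, TopologicalSpace (V q)]
    [∀ q, AddCommMonoid (V q)] [∀ q, Module ℝ (V q)] [FiberBundle F V] [VectorBundle ℝ F V]
    [ContMDiffVectorBundle n F V I]
    (hV : ∀ p : N, (chartAt H p).source ⊆ (trivializationAt F V p).baseSet) {s : Π q, V q} :
    ContMDiff I (I.prod 𝓘(ℝ, F)) n (fun q => TotalSpace.mk' F q (s q)) ↔
      ∀ p : N, ContDiffOn ℝ n (fun y =>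
        (trivializationAt F V p ⟨(extChartAt I p).symm y, s ((extChartAt I p).symm y)⟩).2)
        (extChartAt I p).target := by
  have hchart : ∀ p : N, ContMDiffOn I (I.prod 𝓘(ℝ, F)) n (fun q => TotalSpace.mk' F q (s q))
      (chartAt H p).source ↔ _ := fun p =>
    ((trivializationAt F V p).contMDiffOn_section_iff (chartAt H p).open_source (hV p)).trans
      contMDiffOn_chartAt_source_iff
  refine ⟨fun h p => (hchart p).1 h.contMDiffOn, fun h p => ?_⟩
  exact ((hchart p).2 (h p)).contMDiffAt ((chartAt H p).open_source.mem_nhds (mem_chart_source H p))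

variable [IsManifold I ∞ N]

theorem smoothVectorField_iff_contDiffOn {X : Π q : N, TangentSpace I q} :
    SmoothVectorField I X ↔
      ∀ p : N, ContDiffOn ℝ ∞ (vectorFieldInChart I X p) (extChartAt I p).target := by
  refine (contMDiff_section_iff_contDiffOn (V := TangentSpace I) fun p => subset_rfl).trans ?_
  exact forall_congr' fun p => contDiffOn_congr fun y hy =>
    trivializationAt_eq_chartDeriv (symm_mem_chartAt_source hy) _

theorem smoothOneForm_iff_contDiffOn {α : Π q : N, TangentSpace I q →L[ℝ] ℝ} :
    SmoothOneForm I α ↔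
      ∀ p : N, ContDiffOn ℝ ∞ (oneFormInChart I α p) (extChartAt I p).target := by
  refine (contMDiff_section_iff_contDiffOn
    (V := fun q : N => TangentSpace I q →L[ℝ] Bundle.Trivial N ℝ q)
    fun p q hq => show q ∈ _ ∩ univ from ⟨hq, mem_univ q⟩).trans ?_
  refine forall_congr' fun p => contDiffOn_congr fun y hy => ?_
  exact ContinuousLinearMap.ext fun ξ => trivializationAt_oneForm_apply hy _ ξ

variable (I) in
/-- The expression of the field of bilinear forms `B` in the preferred chart at `p`. -/
def bilinFormInChart (B : Π q : N, TangentSpace I q →L[ℝ] TangentSpace I q →L[ℝ] ℝ) (p : N)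
    (y : E) : E →L[ℝ] E →L[ℝ] ℝ :=
  ContinuousLinearMap.bilinearComp (E := E) (F := E) (E' := E) (F' := E)
    (B ((extChartAt I p).symm y)) (chartDerivSymm I p y) (chartDerivSymm I p y)

theorem contMDiff_iff_contDiffOn_bilinFormInChart
    {B : Π q : N, TangentSpace I q →L[ℝ] TangentSpace I q →L[ℝ] ℝ} :
    ContMDiff I (I.prod 𝓘(ℝ, E →L[ℝ] E →L[ℝ] ℝ)) ∞
      (fun q : N => TotalSpace.mk' (E →L[ℝ] E →L[ℝ] ℝ)
        (E := fun q : N => TangentSpace I q →L[ℝ] TangentSpace I q →L[ℝ] Bundle.Trivial N ℝ q)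
        q (B q)) ↔
      ∀ p : N, ContDiffOn ℝ ∞ (bilinFormInChart I B p) (extChartAt I p).target := by
  refine (contMDiff_section_iff_contDiffOn
    (V := fun q : N => TangentSpace I q →L[ℝ] TangentSpace I q →L[ℝ] Bundle.Trivial N ℝ q)
    fun p q hq => show q ∈ _ ∩ (_ ∩ univ) from ⟨hq, hq, mem_univ q⟩).trans ?_
  refine forall_congr' fun p => contDiffOn_congr fun y hy => ?_
  exact ContinuousLinearMap.ext fun ξ => ContinuousLinearMap.ext fun η =>
    trivializationAt_bilinForm_apply hy _ ξ η

end Charts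

section Naturality

variable {E : Type*} [NormedAddCommGroup E] [NormedSpace ℝ E]
  {H : Type*} [TopologicalSpace H] {I : ModelWithCorners ℝ E H}
  {N : Type*} [TopologicalSpace N] [ChartedSpace H N]
  {E' : Type*} [NormedAddCommGroup E'] [NormedSpace ℝ E']
  {H' : Type*} [TopologicalSpace H'] {I' : ModelWithCorners ℝ E' H'}
  {N' : Type*} [TopologicalSpace N'] [ChartedSpace H' N']
  {E'' : Type*} [NormedAddCommGroup E''] [NormedSpace ℝ E'']
  {H'' : Type*} [TopologicalSpace H''] {I'' : ModelWithCorners ℝ E'' H''}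
  {N'' : Type*} [TopologicalSpace N''] [ChartedSpace H'' N'']

variable (I I') in
/-- The pullback `f^* α` of the 1-form `α` under the map `f`. -/
def pullbackOneForm (f : N → N') (α : Π q : N', TangentSpace I' q →L[ℝ] ℝ) (p : N) :
    TangentSpace I p →L[ℝ] ℝ :=
  (α (f p)).comp (mfderiv I I' f p)

theorem pullbackOneForm_congr {f f' : N → N'} {p : N} (h : f =ᶠ[𝓝 p] f')
    (α : Π q : N', TangentSpace I' q →L[ℝ] ℝ) :
    pullbackOneForm I I' f α p = pullbackOneForm I I' f' α p := by
  have hα : ∀ (q q' : N') (_ : q = q') (T : TangentSpace I p →L[ℝ] E'),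
      ContinuousLinearMap.comp (α q : E' →L[ℝ] ℝ) T =
        ContinuousLinearMap.comp (α q' : E' →L[ℝ] ℝ) T := by
    rintro q q' rfl T
    rfl
  exact (hα _ _ h.self_of_nhds _).trans
    (congrArg (ContinuousLinearMap.comp (α (f' p) : E' →L[ℝ] ℝ)) h.mfderiv_eq)

theorem pullbackOneForm_comp {f : N' → N''} {h : N → N'} {p : N}
    (hf : MDifferentiableAt I' I'' f (h p)) (hh : MDifferentiableAt I I' h p)
    (α : Π q : N'', TangentSpace I'' q →L[ℝ] ℝ) :
    pullbackOneForm I I'' (f ∘ h) α p = pullbackOneForm I I' h (pullbackOneForm I' I'' f α) p := by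
  rw [pullbackOneForm, mfderiv_comp p hf hh]
  rfl

variable [I.Boundaryless] [I'.Boundaryless]

theorem oneFormInChart_eq_pullbackOneForm (α : Π q : N, TangentSpace I q →L[ℝ] ℝ) (p : N) :
    oneFormInChart I α p = pullbackOneForm 𝓘(ℝ, E) I (extChartAt I p).symm α := by
  ext1 y
  rw [oneFormInChart, I.range_eq_univ, mfderivWithin_univ]
  rfl

theorem mdifferentiableAt_extChartAt_symm [IsManifold I 1 N] {p : N} {y : E}
    (hy : y ∈ (extChartAt I p).target) :
    MDifferentiableAt 𝓘(ℝ, E) I (extChartAt I p).symm y := by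
  rw [← mdifferentiableWithinAt_univ, ← I.range_eq_univ]
  exact mdifferentiableWithinAt_extChartAt_symm hy

theorem extDerivOneForm_apply [IsManifold I 1 N] {α : Π q : N, TangentSpace I q →L[ℝ] ℝ} {p : N}
    (hα : DifferentiableAt ℝ (oneFormInChart I α p) (extChartAt I p p)) (X Y : TangentSpace I p) :
    extDerivOneForm I α p ![X, Y] =
      extDerivBilin (oneFormInChart I α p) (extChartAt I p p) X Y := by
  rw [extDerivOneForm, mfderiv_extChartAt_self, I.range_eq_univ, extDerivWithin_univ]
  exact extDeriv_ofSubsingleton_apply hα X Y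

theorem oneFormInChart_pullbackOneForm_eventuallyEq [IsManifold I 1 N] [IsManifold I' 1 N']
    {f : N → N'} {p : N} (hf : ContMDiffAt I I' 1 f p)
    (α : Π q : N', TangentSpace I' q →L[ℝ] ℝ) :
    oneFormInChart I (pullbackOneForm I I' f α) p =ᶠ[𝓝 (extChartAt I p p)] fun y =>
      (oneFormInChart I' α (f p) (writtenInExtChartAt I I' p f y)).comp
        (fderiv ℝ (writtenInExtChartAt I I' p f) y) := by
  set φ := extChartAt I p
  set ψ := extChartAt I' (f p)
  have hφp : Filter.Tendsto φ.symm (𝓝 (φ p)) (𝓝 p) := by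
    simpa only [ContinuousAt, extChartAt_to_inv] using continuousAt_extChartAt_symm (I := I) p
  have hsource : ∀ᶠ q in 𝓝 p, f q ∈ ψ.source :=
    hf.continuousAt.eventually_mem (extChartAt_source_mem_nhds (f p))
  filter_upwards [extChartAt_target_mem_nhds p, hφp.eventually hsource.eventually_nhds,
    hφp.eventually ((contMDiffAt_iff_contMDiffAt_nhds (by simp)).1 hf)] with y hy hfy hdf
  have hφ : MDifferentiableAt 𝓘(ℝ, E) I φ.symm y := mdifferentiableAt_extChartAt_symm hy
  have hfφ : MDifferentiableAt 𝓘(ℝ, E) I' (f ∘ φ.symm) y :=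
    (hdf.mdifferentiableAt (by simp)).comp y hφ
  have hτ : MDifferentiableAt 𝓘(ℝ, E) 𝓘(ℝ, E') (writtenInExtChartAt I I' p f) y :=
    (mdifferentiableAt_extChartAt (extChartAt_source I' (f p) ▸ hfy.self_of_nhds)).comp y hfφ
  have hψ : MDifferentiableAt 𝓘(ℝ, E') I' ψ.symm (writtenInExtChartAt I I' p f y) :=
    mdifferentiableAt_extChartAt_symm (ψ.map_source hfy.self_of_nhds)
  rw [oneFormInChart_eq_pullbackOneForm, oneFormInChart_eq_pullbackOneForm, ← mfderiv_eq_fderiv,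
    ← pullbackOneForm_comp (hdf.mdifferentiableAt (by simp)) hφ]
  have hψτ : f ∘ φ.symm =ᶠ[𝓝 y] ψ.symm ∘ writtenInExtChartAt I I' p f :=
    ((continuousAt_extChartAt_symm'' hy).eventually hfy).mono fun z hz => (ψ.left_inv hz).symm
  exact (pullbackOneForm_congr hψτ α).trans (pullbackOneForm_comp hψ hτ α)

theorem extDerivOneForm_pullbackOneForm [IsManifold I 1 N] [IsManifold I' 1 N']
    {f : N → N'} {p : N} (hf : ContMDiffAt I I' 2 f p)
    {α : Π q : N', TangentSpace I' q →L[ℝ] ℝ}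
    (hα : DifferentiableAt ℝ (oneFormInChart I' α (f p)) (extChartAt I' (f p) (f p)))
    (X Y : TangentSpace I p) :
    extDerivOneForm I (pullbackOneForm I I' f α) p ![X, Y] =
      extDerivOneForm I' α (f p) ![mfderiv I I' f p X, mfderiv I I' f p Y] := by
  set τ := writtenInExtChartAt I I' p f
  have hτp : τ (extChartAt I p p) = extChartAt I' (f p) (f p) := by
    simp [τ, writtenInExtChartAt]
  have hτ : ContDiffAt ℝ 2 τ (extChartAt I p p) := by
    have := (contMDiffAt_iff.1 hf).2
    rwa [I.range_eq_univ, contDiffWithinAt_univ] at this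
  have hdf : mfderiv I I' f p = fderiv ℝ τ (extChartAt I p p) := by
    rw [(hf.mdifferentiableAt (by norm_num)).mfderiv, I.range_eq_univ, fderivWithin_univ]
  have heq := oneFormInChart_pullbackOneForm_eventuallyEq (hf.of_le (by norm_num)) α
  have hτ' : ContDiffAt ℝ 1 (fderiv ℝ τ) (extChartAt I p p) :=
    hτ.fderiv_right (m := 1) (by norm_num)
  rw [← hτp] at hα
  have hdiff : DifferentiableAt ℝ (oneFormInChart I (pullbackOneForm I I' f α) p)
      (extChartAt I p p) :=
    ((hα.comp _ (hτ.differentiableAt (by norm_num))).clm_comp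
      (hτ'.differentiableAt (by norm_num))).congr_of_eventuallyEq heq
  rw [extDerivOneForm_apply hdiff, extDerivOneForm_apply (hτp ▸ hα), hdf, ← hτp]
  refine Eq.trans ?_ (extDerivBilin_pullback hα hτ X Y)
  rw [extDerivBilin, heq.fderiv_eq]
  rfl

end Naturality

/-! ### Interior products and nondegenerate 2-forms -/

section InteriorProduct

theorem update_vecCons_one {V : Type*} (X Y Z : V) : Function.update ![X, Z] 1 Y = ![X, Y] := by
  ext i
  fin_cases i <;> rfl

variable {V : Type*} [AddCommGroup V] [Module ℝ V] [TopologicalSpace V]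

/-- The interior product `X ⌟ Ω` of a vector `X` and a 2-form `Ω`. The entry `0` in its definition
is a placeholder for the second argument. -/
def interiorProduct (Ω : V [⋀^Fin 2]→L[ℝ] ℝ) : V →ₗ[ℝ] V →L[ℝ] ℝ where
  toFun X := Ω.toContinuousMultilinearMap.toContinuousLinearMap ![X, 0] 1
  map_add' X X' := by
    ext Y
    simpa [update_vecCons_one] using Ω.toContinuousMultilinearMap.cons_add ![Y] X X'
  map_smul' c X := by
    ext Y
    simpa [update_vecCons_one] using Ω.toContinuousMultilinearMap.cons_smul ![Y] c X

theorem interiorProduct_apply (Ω : V [⋀^Fin 2]→L[ℝ] ℝ) (X Y : V) :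
    interiorProduct Ω X Y = Ω ![X, Y] :=
  congrArg Ω (update_vecCons_one X Y 0)

theorem interiorProduct_swap (Ω : V [⋀^Fin 2]→L[ℝ] ℝ) (X Y : V) :
    interiorProduct Ω Y X = -interiorProduct Ω X Y := by
  have hswap : ![X, Y] ∘ Equiv.swap 0 1 = ![Y, X] := by
    ext i
    fin_cases i <;> rfl
  rw [interiorProduct_apply, interiorProduct_apply, ← hswap]
  exact Ω.toAlternatingMap.map_swap ![X, Y] zero_ne_one

/-- A 2-form `Ω` is strongly nondegenerate if `X ↦ X ⌟ Ω` is a bijection onto the continuous dual;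
in finite dimension this says that `Ω` has no kernel. -/
def IsStronglyNondegenerate (Ω : V [⋀^Fin 2]→L[ℝ] ℝ) : Prop :=
  Function.Bijective (interiorProduct Ω)

theorem isStronglyNondegenerate_of_exact {F : Type*} [AddCommGroup F] [Module ℝ F]
    [TopologicalSpace F] {Ω : V [⋀^Fin 2]→L[ℝ] ℝ} {ι s : F →L[ℝ] V} {P : V →L[ℝ] F}
    {B : F →L[ℝ] F →L[ℝ] ℝ} (hιP : Function.Exact ι P) (hs : Function.RightInverse s P)
    (hB : ∀ v w, B v w = B w v) (hB_bij : Function.Bijective B)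
    (hΩ : ∀ X w, Ω ![X, ι w] = -B w (P X)) : IsStronglyNondegenerate Ω := by
  have hB_zero {a : F} (ha : ∀ w, B w a = 0) : a = 0 :=
    (map_eq_zero_iff _ hB_bij.1).1 (ContinuousLinearMap.ext fun w => (hB a w).trans (ha w))
  have hright (X : V) (w : F) : interiorProduct Ω X (ι w) = -B w (P X) :=
    (interiorProduct_apply Ω X (ι w)).trans (hΩ X w)
  have hleft (w : F) (Y : V) : interiorProduct Ω (ι w) Y = B w (P Y) := by
    rw [interiorProduct_swap, hright, neg_neg]
  constructor
  · refine (injective_iff_map_eq_zero _).2 fun X hX => ?_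
    have hPX : P X = 0 := hB_zero fun w => by
      rw [← neg_eq_zero, ← hright, hX, zero_apply]
    obtain ⟨b, rfl⟩ := (hιP X).1 hPX
    rw [hB_zero (a := b) fun y => ?_, map_zero]
    rw [hB, ← hs y, ← hleft, hX, zero_apply]
  · intro β
    obtain ⟨a, ha⟩ := hB_bij.2 (-β.comp ι)
    obtain ⟨b, hb⟩ := hB_bij.2 ((β - interiorProduct Ω (s a)).comp s)
    refine ⟨s a + ι b, ContinuousLinearMap.ext fun Y => ?_⟩
    have hvertical (w : F) : interiorProduct Ω (s a + ι b) (ι w) = β (ι w) := by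
      rw [hright, map_add, hs, hιP.apply_apply_eq_zero, add_zero, hB, ha]
      simp
    have hhorizontal (y : F) : interiorProduct Ω (s a + ι b) (s y) = β (s y) := by
      rw [map_add, add_apply, hleft, hs, hb]
      simp
    obtain ⟨w, hw⟩ := (hιP (Y - s (P Y))).1 (by rw [map_sub, hs, sub_self])
    rw [← sub_add_cancel Y (s (P Y)), ← hw, map_add (interiorProduct Ω _), hvertical,
      hhorizontal, map_add]

end InteriorProduct

theorem contDiffAt_inverse_apply {W F F' : Type*} [NormedAddCommGroup W] [NormedSpace ℝ W]
    [NormedAddCommGroup F] [NormedSpace ℝ F] [CompleteSpace F]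
    [NormedAddCommGroup F'] [NormedSpace ℝ F'] {n : ℕ∞ω} {A : W → F →L[ℝ] F'} {c : W → F'}
    {w : W} (hA : ContDiffAt ℝ n A w) (hw : (A w).IsInvertible) (hc : ContDiffAt ℝ n c w) :
    ContDiffAt ℝ n (fun w => (A w).inverse (c w)) w := by
  obtain ⟨e, he⟩ := hw
  have h : ContDiffAt ℝ n (ContinuousLinearMap.inverse : (F →L[ℝ] F') → F' →L[ℝ] F) (A w) :=
    he ▸ contDiffAt_map_inverse e
  exact (h.comp w hA).clm_apply hc

section Smoothness

variable {E : Type*} [NormedAddCommGroup E] [NormedSpace ℝ E]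
  {H : Type*} [TopologicalSpace H] {I : ModelWithCorners ℝ E H}
  {N : Type*} [TopologicalSpace N] [ChartedSpace H N]

theorem oneFormInChart_modelSpace (β : Π z : E, TangentSpace 𝓘(ℝ, E) z →L[ℝ] ℝ)
    (y : E) : oneFormInChart 𝓘(ℝ, E) β y = β := by
  rw [oneFormInChart_eq_pullbackOneForm, extChartAt_model_space_eq_id]
  ext1 z
  change (β z).comp (mfderiv 𝓘(ℝ, E) 𝓘(ℝ, E) id z) = β z
  rw [mfderiv_id]
  rfl

theorem extDerivOneForm_modelSpace {β : E → E →L[ℝ] ℝ} {y : E} (hβ : DifferentiableAt ℝ β y)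
    (ξ η : E) : extDerivOneForm 𝓘(ℝ, E) β y ![ξ, η] = extDerivBilin β y ξ η := by
  have hchart : oneFormInChart 𝓘(ℝ, E) β y = β := oneFormInChart_modelSpace β y
  exact (extDerivOneForm_apply (hchart.symm ▸ hβ) ξ η).trans (by rw [hchart]; rfl)

section

variable [IsManifold I 1 N] {α β : Π q : N, TangentSpace I q →L[ℝ] ℝ}

theorem SmoothOneForm.neg (hα : SmoothOneForm I α) : SmoothOneForm I fun p => -α p :=
  ContMDiff.neg_section hα

theorem SmoothOneForm.add (hα : SmoothOneForm I α) (hβ : SmoothOneForm I β) :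
    SmoothOneForm I fun p => α p + β p :=
  ContMDiff.add_section hα hβ

end

variable [I.Boundaryless] [IsManifold I ∞ N] {α : Π q : N, TangentSpace I q →L[ℝ] ℝ}
  {p : N} {y : E}

theorem SmoothOneForm.differentiableAt_oneFormInChart (hα : SmoothOneForm I α)
    (hy : y ∈ (extChartAt I p).target) : DifferentiableAt ℝ (oneFormInChart I α p) y :=
  ((smoothOneForm_iff_contDiffOn.1 hα p).differentiableOn (by simp)).differentiableAt
    ((isOpen_extChartAt_target p).mem_nhds hy)

theorem SmoothOneForm.extDerivOneForm_chartDerivSymm (hα : SmoothOneForm I α)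
    (hy : y ∈ (extChartAt I p).target) (ξ η : E) :
    extDerivOneForm I α ((extChartAt I p).symm y)
        ![chartDerivSymm I p y ξ, chartDerivSymm I p y η] =
      extDerivBilin (oneFormInChart I α p) y ξ η := by
  have hφ : ContMDiffAt 𝓘(ℝ, E) I 2 (extChartAt I p).symm y :=
    (contMDiffOn_extChartAt_symm p).contMDiffAt ((isOpen_extChartAt_target p).mem_nhds hy)
  have hd : chartDerivSymm I p y = mfderiv 𝓘(ℝ, E) I (extChartAt I p).symm y := by
    rw [chartDerivSymm, I.range_eq_univ, mfderivWithin_univ]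
  rw [hd, ← extDerivOneForm_modelSpace (hα.differentiableAt_oneFormInChart hy),
    oneFormInChart_eq_pullbackOneForm]
  exact (extDerivOneForm_pullbackOneForm hφ
    (hα.differentiableAt_oneFormInChart (mem_extChartAt_target _)) ξ η).symm

variable (I) in
/-- The 1-form `X ⌟ dα`. -/
def interiorExtDeriv (X : Π q : N, TangentSpace I q) (α : Π q : N, TangentSpace I q →L[ℝ] ℝ)
    (p : N) : TangentSpace I p →L[ℝ] ℝ :=
  interiorProduct (extDerivOneForm I α p) (X p)

theorem SmoothOneForm.oneFormInChart_interiorExtDeriv (hα : SmoothOneForm I α)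
    (X : Π q : N, TangentSpace I q) (hy : y ∈ (extChartAt I p).target) :
    oneFormInChart I (interiorExtDeriv I X α) p y =
      extDerivBilin (oneFormInChart I α p) y (vectorFieldInChart I X p y) := by
  ext η
  rw [← hα.extDerivOneForm_chartDerivSymm hy, chartDerivSymm_vectorFieldInChart X hy]
  exact interiorProduct_apply (extDerivOneForm I α _) _ _

theorem smoothOneForm_interiorExtDeriv (hα : SmoothOneForm I α) {X : Π q : N, TangentSpace I q}
    (hX : SmoothVectorField I X) : SmoothOneForm I (interiorExtDeriv I X α) :=
  smoothOneForm_iff_contDiffOn.2 fun p =>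
    ((contDiffOn_extDerivBilin (smoothOneForm_iff_contDiffOn.1 hα p)
      (isOpen_extChartAt_target p)).clm_apply (smoothVectorField_iff_contDiffOn.1 hX p)).congr
      fun _ hy => hα.oneFormInChart_interiorExtDeriv X hy

theorem smoothOneForm_differential {f : N → ℝ} (hf : ContMDiff I 𝓘(ℝ, ℝ) ∞ f) :
    SmoothOneForm I (differential I f) := by
  refine smoothOneForm_iff_contDiffOn.2 fun p => ?_
  have hfφ : ContDiffOn ℝ ∞ (f ∘ (extChartAt I p).symm) (extChartAt I p).target :=
    contMDiffOn_chartAt_source_iff.1 hf.contMDiffOn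
  refine (hfφ.fderiv_of_isOpen (m := ∞) (isOpen_extChartAt_target p) (by simp)).congr
    fun y hy => ?_
  rw [← mfderiv_eq_fderiv, oneFormInChart_eq_pullbackOneForm]
  exact (mfderiv_comp y (hf.mdifferentiableAt (by simp))
    (mdifferentiableAt_extChartAt_symm hy)).symm

theorem SmoothOneForm.isInvertible_extDerivBilin [CompleteSpace E] (hα : SmoothOneForm I α)
    (hy : y ∈ (extChartAt I p).target)
    (hdα : IsStronglyNondegenerate (extDerivOneForm I α ((extChartAt I p).symm y))) :
    (extDerivBilin (oneFormInChart I α p) y).IsInvertible := by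
  set q := (extChartAt I p).symm y
  have hchart : ∀ ξ η, extDerivBilin (oneFormInChart I α p) y ξ η =
      interiorProduct (extDerivOneForm I α q) (chartDerivSymm I p y ξ) (chartDerivSymm I p y η) :=
    fun ξ η => by rw [← hα.extDerivOneForm_chartDerivSymm hy, interiorProduct_apply]
  have hinj : Function.Injective (extDerivBilin (oneFormInChart I α p) y) := by
    refine (injective_iff_map_eq_zero _).2 fun ξ hξ => ?_
    have hzero : interiorProduct (extDerivOneForm I α q) (chartDerivSymm I p y ξ) = 0 := by
      ext Y
      rw [← chartDerivSymm_chartDeriv hy Y, ← hchart, hξ]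
      rfl
    rw [← chartDeriv_chartDerivSymm hy ξ, (map_eq_zero_iff _ hdα.1).1 hzero, map_zero]
  have hsurj : Function.Surjective (extDerivBilin (oneFormInChart I α p) y) := by
    intro b
    obtain ⟨X, hX⟩ := hdα.2 (b.comp (chartDeriv I p q))
    refine ⟨chartDeriv I p q X, ContinuousLinearMap.ext fun η => ?_⟩
    rw [hchart, chartDerivSymm_chartDeriv hy, hX, ContinuousLinearMap.comp_apply,
      chartDeriv_chartDerivSymm hy]
  exact ⟨ContinuousLinearEquiv.ofBijective _ (LinearMap.ker_eq_bot.2 hinj)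
    (LinearMap.range_eq_top.2 hsurj), rfl⟩

-- In a chart, `X` is obtained by applying the inverse of `dα` to `X ⌟ dα`, and inversion of bounded
-- operators is smooth.
theorem SmoothOneForm.smoothVectorField_of_interiorExtDeriv [CompleteSpace E]
    (hα : SmoothOneForm I α) (hdα : ∀ p, IsStronglyNondegenerate (extDerivOneForm I α p))
    {X : Π q : N, TangentSpace I q} (hX : SmoothOneForm I (interiorExtDeriv I X α)) :
    SmoothVectorField I X := by
  rw [smoothOneForm_iff_contDiffOn] at hX
  refine smoothVectorField_iff_contDiffOn.2 fun p => ?_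
  have hB := contDiffOn_extDerivBilin (smoothOneForm_iff_contDiffOn.1 hα p)
    (isOpen_extChartAt_target p)
  refine ContDiffOn.congr (f := fun y => (extDerivBilin (oneFormInChart I α p) y).inverse
    (oneFormInChart I (interiorExtDeriv I X α) p y)) (fun y hy => ?_) fun y hy => ?_
  · have hnhds := (isOpen_extChartAt_target p).mem_nhds hy
    exact (contDiffAt_inverse_apply (hB.contDiffAt hnhds)
      (hα.isInvertible_extDerivBilin hy (hdα _)) ((hX p).contDiffAt hnhds)).contDiffWithinAt
  · obtain ⟨e, he⟩ := hα.isInvertible_extDerivBilin hy (hdα _)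
    rw [hα.oneFormInChart_interiorExtDeriv X hy, ← he, ContinuousLinearMap.inverse_equiv]
    exact (e.symm_apply_apply _).symm

end Smoothness

/-! ### Vertical lifts and the Liouville form -/

section TangentBundle

variable {E : Type*} [NormedAddCommGroup E] [NormedSpace ℝ E]
  {H : Type*} [TopologicalSpace H] {I : ModelWithCorners ℝ E H}
  {M : Type*} [TopologicalSpace M] [ChartedSpace H M]

section

variable [IsManifold I 1 M] {p v : TangentBundle I M} {z : E × E}

theorem extChartAt_tangent_apply (hv : v.proj ∈ (chartAt H p.proj).source) :
    extChartAt I.tangent p v =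
      (extChartAt I p.proj v.proj, chartDeriv I p.proj v.proj v.snd) := by
  rw [← trivializationAt_eq_chartDeriv hv]
  exact congrFun (congrArg PartialEquiv.toFun (FiberBundle.extChartAt (IB := I) p)) v

theorem proj_extChartAt_tangent_symm_mem_source (hz : z ∈ (extChartAt I.tangent p).target) :
    ((extChartAt I.tangent p).symm z).proj ∈ (chartAt H p.proj).source :=
  (TangentBundle.mem_chart_source_iff _ p).1 (symm_mem_chartAt_source hz)

theorem extChartAt_tangent_symm_eq (hz : z ∈ (extChartAt I.tangent p).target) :
    (extChartAt I p.proj ((extChartAt I.tangent p).symm z).proj,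
      chartDeriv I p.proj ((extChartAt I.tangent p).symm z).proj
        ((extChartAt I.tangent p).symm z).snd) = z := by
  rw [← extChartAt_tangent_apply (proj_extChartAt_tangent_symm_mem_source hz),
    (extChartAt I.tangent p).right_inv hz]

theorem fst_mem_extChartAt_target (hz : z ∈ (extChartAt I.tangent p).target) :
    z.1 ∈ (extChartAt I p.proj).target := by
  rw [← extChartAt_tangent_symm_eq hz]
  exact (extChartAt I p.proj).map_source
    (extChartAt_source I p.proj ▸ proj_extChartAt_tangent_symm_mem_source hz)

end

variable [IsManifold I ∞ M]

theorem mdifferentiableAt_tangentBundle_proj (v : TangentBundle I M) :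
    MDifferentiableAt I.tangent I (fun w : TangentBundle I M => w.proj) v :=
  have : ContMDiffVectorBundle 1 E (TangentSpace I : M → Type _) I :=
    ContMDiffVectorBundle.of_le (n := ∞) (by simp)
  mdifferentiableAt_proj (TangentSpace I : M → Type _)

theorem chartDeriv_projTangentMap {p v : TangentBundle I M}
    (hv : v.proj ∈ (chartAt H p.proj).source) (V : TangentSpace I.tangent v) :
    chartDeriv I p.proj v.proj (projTangentMap I v V) = (chartDeriv I.tangent p v V).1 := by
  have hv' : v ∈ (chartAt (ModelProd H E) p).source := (TangentBundle.mem_chart_source_iff v p).2 hv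
  have hproj : (extChartAt I p.proj ∘ fun w : TangentBundle I M => w.proj) =ᶠ[𝓝 v]
      Prod.fst ∘ extChartAt I.tangent p := by
    filter_upwards [(chartAt (ModelProd H E) p).open_source.mem_nhds hv'] with w hw
    rw [Function.comp_apply, Function.comp_apply,
      extChartAt_tangent_apply ((TangentBundle.mem_chart_source_iff w p).1 hw)]
  have hderiv := hproj.mfderiv_eq (I := I.tangent) (I' := 𝓘(ℝ, E))
  rw [mfderiv_comp v (mdifferentiableAt_extChartAt hv) (mdifferentiableAt_tangentBundle_proj v),
    mfderiv_comp v differentiableAt_fst.mdifferentiableAt (mdifferentiableAt_extChartAt hv'),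
    mfderiv_eq_fderiv, fderiv_fst] at hderiv
  exact DFunLike.congr_fun hderiv V

-- Through the preferred chart at `v`, the type `TangentSpace I.tangent v` is by definition `E × E`,
-- with the horizontal component first.
theorem projTangentMap_apply (v : TangentBundle I M) (V : TangentSpace I.tangent v) :
    projTangentMap I v V = (V : E × E).1 := by
  have h := chartDeriv_projTangentMap (mem_chart_source H v.proj) V
  rwa [chartDeriv_self, chartDeriv_self] at h

theorem exists_projTangentMap_rightInverse (v : TangentBundle I M) :
    ∃ s : TangentSpace I v.proj →L[ℝ] TangentSpace I.tangent v,
      Function.RightInverse s (projTangentMap I v) :=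
  ⟨ContinuousLinearMap.inl ℝ E E, fun _ => projTangentMap_apply v _⟩

theorem hasMFDerivAt_tangentBundle_mk (x : M) (w : E) :
    HasMFDerivAt 𝓘(ℝ, E) I.tangent (fun w : E => (⟨x, w⟩ : TangentBundle I M)) w
      (ContinuousLinearMap.inr ℝ E E) := by
  refine ⟨(FiberBundle.continuous_totalSpaceMk E (TangentSpace I : M → Type _) x).continuousAt, ?_⟩
  have hchart : writtenInExtChartAt 𝓘(ℝ, E) I.tangent w
      (fun w : E => (⟨x, w⟩ : TangentBundle I M)) = fun w => (extChartAt I x x, w) :=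
    funext fun w' => (extChartAt_tangent_apply (mem_chart_source H x)).trans
      (Prod.ext rfl (chartDeriv_self x w'))
  rw [hchart]
  exact ((hasFDerivAt_const _ _).prodMk (hasFDerivAt_id _)).hasFDerivWithinAt

variable (I) in
/-- The vertical lift `T_x M → T_v(TM)` at `v ∈ T_x M`, which identifies `T_x M` with the tangent
space at `v` of the fibre `T_x M` of `TM`. -/
def verticalLift (v : TangentBundle I M) :
    TangentSpace I v.proj →L[ℝ] TangentSpace I.tangent v :=
  mfderiv 𝓘(ℝ, E) I.tangent (fun w : E => (⟨v.proj, w⟩ : TangentBundle I M)) v.snd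

theorem verticalLift_eq_inr (v : TangentBundle I M) :
    verticalLift I v = ContinuousLinearMap.inr ℝ E E :=
  (hasMFDerivAt_tangentBundle_mk (E := E) v.proj v.snd).mfderiv

theorem exact_verticalLift_projTangentMap (v : TangentBundle I M) :
    Function.Exact (verticalLift I v) (projTangentMap I v) := fun V => by
  rw [projTangentMap_apply, verticalLift_eq_inr]
  exact ⟨fun h => ⟨(V : E × E).2, Prod.ext h.symm rfl⟩, fun ⟨w, hw⟩ => hw ▸ rfl⟩

theorem projTangentMap_fieldTangentMap {u : Π x : M, TangentSpace I x}
    (hu : SmoothVectorField I u) (x : M) (Y : TangentSpace I x) :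
    projTangentMap I (fieldSection I u x) (fieldTangentMap I u x Y) = Y := by
  have hcomp := mfderiv_comp x (mdifferentiableAt_tangentBundle_proj (fieldSection I u x))
    (hu.mdifferentiableAt (x := x) (by simp))
  exact DFunLike.congr_fun (hcomp.symm.trans mfderiv_id) Y

end TangentBundle

section LiouvilleForm

variable {E : Type*} [NormedAddCommGroup E] [NormedSpace ℝ E]
  {H : Type*} [TopologicalSpace H] {I : ModelWithCorners ℝ E H}
  {M : Type*} [TopologicalSpace M] [ChartedSpace H M] [IsManifold I ∞ M]

theorem bilinFormInChart_chartDeriv (B : Π q : M, TangentSpace I q →L[ℝ] TangentSpace I q →L[ℝ] ℝ)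
    {p q : M} (hq : q ∈ (chartAt H p).source) (X Y : TangentSpace I q) :
    bilinFormInChart I B p (extChartAt I p q) (chartDeriv I p q X) (chartDeriv I p q Y) =
      B q X Y := by
  rw [← extChartAt_source I] at hq
  obtain ⟨y, hy, rfl⟩ : ∃ y ∈ (extChartAt I p).target, (extChartAt I p).symm y = q :=
    ⟨_, (extChartAt I p).map_source hq, (extChartAt I p).left_inv hq⟩
  rw [(extChartAt I p).right_inv hy]
  exact congrArg₂ (fun X Y => B ((extChartAt I p).symm y) X Y)
    (chartDerivSymm_chartDeriv hy X) (chartDerivSymm_chartDeriv hy Y)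

theorem bilinFormInChart_self (B : Π q : M, TangentSpace I q →L[ℝ] TangentSpace I q →L[ℝ] ℝ)
    (p : M) (X Y : TangentSpace I p) :
    bilinFormInChart I B p (extChartAt I p p) X Y = B p X Y :=
  (congrArg₂ (fun X Y : E => bilinFormInChart I B p (extChartAt I p p) X Y)
    (chartDeriv_self p X) (chartDeriv_self p Y)).symm.trans
    (bilinFormInChart_chartDeriv B (mem_chart_source H p) X Y)

theorem NondegenerateMetric.oneFormInChart_liouvilleForm (g : NondegenerateMetric I M)
    {p : TangentBundle I M} {z : E × E} (hz : z ∈ (extChartAt I.tangent p).target) :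
    oneFormInChart I.tangent g.liouvilleForm p z =
      (bilinFormInChart I g.toFun p.proj z.1 z.2).comp (ContinuousLinearMap.fst ℝ E E) := by
  have hq := proj_extChartAt_tangent_symm_mem_source hz
  obtain ⟨hz₁, hz₂⟩ := Prod.ext_iff.1 (extChartAt_tangent_symm_eq hz)
  refine ContinuousLinearMap.ext fun ζ => ?_
  have hπ := (chartDeriv_projTangentMap hq _).trans
    (congrArg Prod.fst (chartDeriv_chartDerivSymm hz ζ))
  have hG := congrArg₂ (fun y w => bilinFormInChart I g.toFun p.proj y w) hz₁ hz₂
  have hθ := (bilinFormInChart_chartDeriv g.toFun hq _ _).symm.trans (DFunLike.congr hG hπ)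
  exact hθ

theorem NondegenerateMetric.smoothOneForm_liouvilleForm (g : NondegenerateMetric I M) :
    SmoothOneForm I.tangent g.liouvilleForm := by
  refine smoothOneForm_iff_contDiffOn.2 fun p => ?_
  have hG := (contMDiff_iff_contDiffOn_bilinFormInChart.1 g.contMDiff p.proj).comp
    contDiff_fst.contDiffOn fun z hz => fst_mem_extChartAt_target hz
  exact ((hG.clm_apply contDiff_snd.contDiffOn).clm_comp contDiffOn_const).congr
    fun z hz => g.oneFormInChart_liouvilleForm hz

theorem NondegenerateMetric.contMDiff_kineticEnergy (g : NondegenerateMetric I M) :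
    ContMDiff I.tangent 𝓘(ℝ, ℝ) ∞ g.kineticEnergy := by
  have hid : ContMDiff I.tangent I.tangent ∞ fun v : TangentBundle I M =>
      TotalSpace.mk' E (E := (TangentSpace I : M → Type _)) v.proj v.snd := contMDiff_id
  have hg := g.contMDiff.comp
    (Bundle.contMDiff_proj (F := E) (IB := I) (TangentSpace I : M → Type _))
  have h : ContMDiff I.tangent (I.prod 𝓘(ℝ, ℝ)) ∞ fun v : TangentBundle I M =>
      TotalSpace.mk' ℝ (E := Bundle.Trivial M ℝ) v.proj (g.toFun v.proj v.snd v.snd) :=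
    ContMDiff.clm_bundle_apply₂ (F₁ := E) (F₂ := E) hg hid hid
  exact contMDiff_const.mul fun v => (contMDiffAt_totalSpace.1 (h v)).2

end LiouvilleForm

section SymplecticForm

variable {E : Type*} [NormedAddCommGroup E] [NormedSpace ℝ E]

theorem extDerivBilin_comp_fst_apply_inr {G : E → E →L[ℝ] E →L[ℝ] ℝ}
    {β : E × E → E × E →L[ℝ] ℝ} {z : E × E} (hβ : DifferentiableAt ℝ β z)
    (hβG : β =ᶠ[𝓝 z] fun z => (G z.1 z.2).comp (ContinuousLinearMap.fst ℝ E E))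
    (ζ : E × E) (w : E) :
    extDerivBilin β z ζ (ContinuousLinearMap.inr ℝ E E w) = -G z.1 w ζ.1 := by
  have hβ_apply (η : E × E) : (fun z => β z η) =ᶠ[𝓝 z] fun z => G z.1 z.2 η.1 :=
    hβG.mono fun z' hz' => DFunLike.congr_fun hz' η
  have hzero : fderiv ℝ β z ζ (ContinuousLinearMap.inr ℝ E E w) = 0 := by
    rw [← fderiv_apply_const hβ, (hβ_apply _).fderiv_eq]
    simp
  have hlinear : fderiv ℝ β z (ContinuousLinearMap.inr ℝ E E w) ζ = G z.1 w ζ.1 := by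
    rw [← fderiv_apply_const hβ,
      ← (hβ.clm_apply (differentiableAt_const ζ)).lineDeriv_eq_fderiv, (hβ_apply ζ).lineDeriv_eq]
    simp [lineDeriv]
  rw [extDerivBilin_apply, hzero, hlinear, zero_sub]

theorem hasFDerivAt_half_apply_self {B : E →L[ℝ] E →L[ℝ] ℝ} (hB : ∀ v w, B v w = B w v) (v : E) :
    HasFDerivAt (fun v => 1 / 2 * B v v) (B v) v := by
  refine ((B.hasFDerivAt.clm_apply (hasFDerivAt_id v)).const_mul (1 / 2)).congr_fderiv ?_
  ext w
  simp only [one_div, ContinuousLinearMap.comp_id, id_eq, smul_add, add_apply, smul_apply,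
    smul_eq_mul, ContinuousLinearMap.flip_apply, hB w v]
  ring

variable {H : Type*} [TopologicalSpace H] {I : ModelWithCorners ℝ E H}
  {M : Type*} [TopologicalSpace M] [ChartedSpace H M] [IsManifold I ∞ M]

theorem NondegenerateMetric.differential_kineticEnergy_verticalLift (g : NondegenerateMetric I M)
    (v : TangentBundle I M) (w : TangentSpace I v.proj) :
    differential I.tangent g.kineticEnergy v (verticalLift I v w) = g.toFun v.proj v.snd w := by
  have hcomp := HasMFDerivAt.comp (I := 𝓘(ℝ, E)) (M := E) v.snd
    (g.contMDiff_kineticEnergy.mdifferentiableAt (x := v) (by simp)).hasMFDerivAt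
    (hasMFDerivAt_tangentBundle_mk (E := E) v.proj v.snd)
  have hT := hasFDerivAt_half_apply_self (E := E) (B := g.toFun v.proj) (g.symm v.proj) v.snd
  rw [verticalLift_eq_inr]
  exact DFunLike.congr_fun (hasMFDerivAt_unique hcomp hT.hasMFDerivAt) w

variable [I.Boundaryless]

theorem NondegenerateMetric.symplecticForm_verticalLift (g : NondegenerateMetric I M)
    (v : TangentBundle I M) (X : TangentSpace I.tangent v) (w : TangentSpace I v.proj) :
    g.symplecticForm v ![X, verticalLift I v w] = -g.toFun v.proj w (projTangentMap I v X) := by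
  have hv : (extChartAt I.tangent v v).1 = extChartAt I v.proj v.proj :=
    congrArg Prod.fst (extChartAt_tangent_apply (mem_chart_source H v.proj))
  have hθ := g.smoothOneForm_liouvilleForm.differentiableAt_oneFormInChart
    (mem_extChartAt_target (I := I.tangent) v)
  have hθ_eq := Filter.eventuallyEq_of_mem (extChartAt_target_mem_nhds (I := I.tangent) v)
    fun z hz => g.oneFormInChart_liouvilleForm hz
  rw [verticalLift_eq_inr]
  refine (extDerivOneForm_apply hθ _ _).trans
    ((extDerivBilin_comp_fst_apply_inr hθ hθ_eq X w).trans (congrArg Neg.neg ?_))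
  rw [hv]
  exact (bilinFormInChart_self g.toFun v.proj w (X : E × E).1).trans
    (congrArg _ (projTangentMap_apply v X).symm)

end SymplecticForm

/-! ### The Newton equation -/

section Nondegeneracy

variable {E : Type*} [NormedAddCommGroup E] [NormedSpace ℝ E]
  {H : Type*} [TopologicalSpace H] {I : ModelWithCorners ℝ E H}
  {M : Type*} [TopologicalSpace M] [ChartedSpace H M]

section

variable [IsManifold I 1 M]

theorem NondegenerateMetric.injective_toFun (g : NondegenerateMetric I M) (x : M) :
    Function.Injective (g.toFun x) :=
  (injective_iff_map_eq_zero _).2 fun a ha => g.nondegenerate x a fun w => by rw [ha]; rfl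

theorem NondegenerateMetric.surjective_toFun_of_finiteDimensional [FiniteDimensional ℝ E]
    (g : NondegenerateMetric I M) (x : M) : Function.Surjective (g.toFun x) := by
  have hdim : Module.finrank ℝ E = Module.finrank ℝ (E →L[ℝ] ℝ) :=
    (Subspace.dual_finrank_eq (K := ℝ) (V := E)).symm.trans
      (LinearMap.toContinuousLinearMap (𝕜 := ℝ) (E := E) (F' := ℝ)).finrank_eq
  exact (LinearMap.injective_iff_surjective_of_finrank_eq_finrank
    (f := (g.toFun x : E →L[ℝ] E →L[ℝ] ℝ).toLinearMap) hdim).1 (g.injective_toFun x)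

theorem NondegenerateMetric.eq_zero_of_forall_apply_eq_zero (g : NondegenerateMetric I M) {x : M}
    {a : TangentSpace I x} (h : ∀ w, g.toFun x w a = 0) : a = 0 :=
  g.nondegenerate x a fun w => (g.symm x a w).trans (h w)

end

variable [IsManifold I ∞ M] [I.Boundaryless]

theorem NondegenerateMetric.isStronglyNondegenerate_symplecticForm (g : NondegenerateMetric I M)
    {v : TangentBundle I M} (hg : Function.Surjective (g.toFun v.proj)) :
    IsStronglyNondegenerate (g.symplecticForm v) :=
  have ⟨_, hs⟩ := exists_projTangentMap_rightInverse v
  isStronglyNondegenerate_of_exact (exact_verticalLift_projTangentMap v) hs (g.symm v.proj)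
    ⟨g.injective_toFun v.proj, hg⟩ (g.symplecticForm_verticalLift v)

end Nondegeneracy

section Newton

variable {E : Type*} [NormedAddCommGroup E] [NormedSpace ℝ E]
  {H : Type*} [TopologicalSpace H] {I : ModelWithCorners ℝ E H}
  {M : Type*} [TopologicalSpace M] [ChartedSpace H M] [IsManifold I ∞ M]
  {g : NondegenerateMetric I M} {D : Π v : TangentBundle I M, TangentSpace I.tangent v}
  {α : Π v : TangentBundle I M, TangentSpace I.tangent v →L[ℝ] ℝ}

theorem newtonEquation_iff_oneForm_eq : NewtonEquation g D α ↔ ∀ v,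
    α v = -(interiorExtDeriv I.tangent D g.liouvilleForm v
      + differential I.tangent g.kineticEnergy v) := by
  refine forall_congr' fun v => ?_
  rw [ContinuousLinearMap.ext_iff]
  refine forall_congr' fun Y => ?_
  rw [add_eq_zero_iff_eq_neg', ← interiorProduct_apply]
  rfl

theorem newtonEquation_iff_interiorExtDeriv_eq : NewtonEquation g D α ↔ ∀ v,
    interiorExtDeriv I.tangent D g.liouvilleForm v =
      -(differential I.tangent g.kineticEnergy v + α v) :=
  newtonEquation_iff_oneForm_eq.trans <| forall_congr' fun v => by
    rw [← add_eq_zero_iff_eq_neg', add_assoc, add_eq_zero_iff_eq_neg]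

variable [I.Boundaryless]

theorem NondegenerateMetric.symplecticForm_add_differential_verticalLift
    (g : NondegenerateMetric I M) (v : TangentBundle I M) (X : TangentSpace I.tangent v)
    (w : TangentSpace I v.proj) :
    g.symplecticForm v ![X, verticalLift I v w]
        + differential I.tangent g.kineticEnergy v (verticalLift I v w) =
      g.toFun v.proj w (v.snd - projTangentMap I v X) := by
  rw [g.symplecticForm_verticalLift, g.differential_kineticEnergy_verticalLift, map_sub,
    g.symm _ v.snd, neg_add_eq_sub]

theorem NewtonEquation.projTangentMap_apply (h : NewtonEquation g D α)
    (hα : IsHorizontalForm I α) (v : TangentBundle I M) : projTangentMap I v (D v) = v.snd := by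
  refine (sub_eq_zero.1 (g.eq_zero_of_forall_apply_eq_zero fun w => ?_)).symm
  have hw := h v (verticalLift I v w)
  rwa [hα.2 v _ ((exact_verticalLift_projTangentMap v).apply_apply_eq_zero w), add_zero,
    g.symplecticForm_add_differential_verticalLift] at hw

theorem existsUnique_isHorizontalForm_newtonEquation (g : NondegenerateMetric I M)
    (hD : IsSecondOrderEquation I D) : ∃! α, IsHorizontalForm I α ∧ NewtonEquation g D α := by
  refine ⟨fun v => -(interiorExtDeriv I.tangent D g.liouvilleForm v
    + differential I.tangent g.kineticEnergy v), ⟨⟨?_, fun v V hV => ?_⟩, ?_⟩, fun α hα => ?_⟩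
  · exact ((smoothOneForm_interiorExtDeriv g.smoothOneForm_liouvilleForm hD.1).add
      (smoothOneForm_differential g.contMDiff_kineticEnergy)).neg
  · obtain ⟨w, rfl⟩ := (exact_verticalLift_projTangentMap v V).1 hV
    rw [neg_apply, add_apply, interiorExtDeriv, interiorProduct_apply]
    exact neg_eq_zero.2 <| (g.symplecticForm_add_differential_verticalLift v (D v) w).trans <| by
      rw [hD.2, sub_self, map_zero]
  · exact newtonEquation_iff_oneForm_eq.2 fun _ => rfl
  · exact funext (newtonEquation_iff_oneForm_eq.1 hα.2)

theorem existsUnique_isSecondOrderEquation_newtonEquation [CompleteSpace E]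
    (hg : ∀ x, Function.Surjective (g.toFun x)) (hα : IsHorizontalForm I α) :
    ∃! D, IsSecondOrderEquation I D ∧ NewtonEquation g D α := by
  have hdθ (v) : IsStronglyNondegenerate (extDerivOneForm I.tangent g.liouvilleForm v) :=
    g.isStronglyNondegenerate_symplecticForm (hg v.proj)
  choose D hD using fun v => (hdθ v).2 (-(differential I.tangent g.kineticEnergy v + α v))
  have hnewton : NewtonEquation g D α := newtonEquation_iff_interiorExtDeriv_eq.2 hD
  have hsmooth : SmoothOneForm I.tangent (interiorExtDeriv I.tangent D g.liouvilleForm) := by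
    rw [funext (newtonEquation_iff_interiorExtDeriv_eq.1 hnewton)]
    exact ((smoothOneForm_differential g.contMDiff_kineticEnergy).add hα.1).neg
  refine ⟨D, ⟨⟨?_, hnewton.projTangentMap_apply hα⟩, hnewton⟩, fun D' hD' => ?_⟩
  · exact g.smoothOneForm_liouvilleForm.smoothVectorField_of_interiorExtDeriv hdθ hsmooth
  · refine funext fun v => (hdθ v).1 ?_
    rw [hD]
    exact newtonEquation_iff_interiorExtDeriv_eq.1 hD'.2 v

end Newton

section IntermediateIntegral

variable {E : Type*} [NormedAddCommGroup E] [NormedSpace ℝ E]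
  {H : Type*} [TopologicalSpace H] {I : ModelWithCorners ℝ E H}
  {M : Type*} [TopologicalSpace M] [ChartedSpace H M] [IsManifold I ∞ M]
  {D : Π v : TangentBundle I M, TangentSpace I.tangent v} {u : Π x : M, TangentSpace I x}

theorem isIntermediateIntegral_iff (hD : ∀ v, projTangentMap I v (D v) = v.snd)
    (hu : SmoothVectorField I u) :
    IsIntermediateIntegral I D u ↔
      ∀ x, fieldTangentMap I u x (u x) = D (fieldSection I u x) := by
  refine forall_congr' fun x => ⟨fun ⟨Y, hY⟩ => ?_, fun h => ⟨u x, h⟩⟩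
  have hYu : Y = u x := by
    rw [← projTangentMap_fieldTangentMap hu x Y, hY]
    exact hD _
  rw [← hYu, hY]

theorem differential_comp_fieldSection {f : TangentBundle I M → ℝ}
    (hf : MDifferentiable I.tangent 𝓘(ℝ, ℝ) f) (hu : SmoothVectorField I u) (x : M)
    (Y : TangentSpace I x) :
    differential I (fun x => f (fieldSection I u x)) x Y =
      differential I.tangent f (fieldSection I u x) (fieldTangentMap I u x Y) :=
  DFunLike.congr_fun (mfderiv_comp x (hf _) (hu.mdifferentiableAt (by simp))) Y

variable [I.Boundaryless]

theorem NondegenerateMetric.extDerivOneForm_field (g : NondegenerateMetric I M)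
    (hu : SmoothVectorField I u) (x : M) (X Y : TangentSpace I x) :
    extDerivOneForm I (fun x => g.toFun x (u x)) x ![X, Y] =
      g.symplecticForm (fieldSection I u x)
        ![fieldTangentMap I u x X, fieldTangentMap I u x Y] := by
  have hpullback : pullbackOneForm I I.tangent (fieldSection I u) g.liouvilleForm =
      fun x => g.toFun x (u x) := by
    ext x Y
    exact congrArg (g.toFun x (u x)) (projTangentMap_fieldTangentMap hu x Y)
  rw [← hpullback]
  exact extDerivOneForm_pullbackOneForm (hu.contMDiffAt.of_le (by norm_cast))
    (g.smoothOneForm_liouvilleForm.differentiableAt_oneFormInChart (mem_extChartAt_target _)) X Y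

theorem NondegenerateMetric.eq_zero_iff_forall_interiorProduct_fieldTangentMap
    (g : NondegenerateMetric I M) (hu : SmoothVectorField I u) {x : M}
    {V : TangentSpace I.tangent (fieldSection I u x)}
    (hV : projTangentMap I (fieldSection I u x) V = 0) :
    V = 0 ↔
      ∀ Y, interiorProduct (g.symplecticForm (fieldSection I u x)) V (fieldTangentMap I u x Y) =
        0 := by
  refine ⟨fun h Y => by rw [h, map_zero, zero_apply], fun h => ?_⟩
  obtain ⟨b, rfl⟩ := (exact_verticalLift_projTangentMap _ V).1 hV
  suffices hb : b = 0 by rw [hb, map_zero]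
  refine g.nondegenerate _ b fun Y => ?_
  rw [← h Y, interiorProduct_swap, interiorProduct_apply, g.symplecticForm_verticalLift, neg_neg]
  exact congrArg (g.toFun x b) (projTangentMap_fieldTangentMap hu x Y).symm

variable {g : NondegenerateMetric I M}
  {α : Π v : TangentBundle I M, TangentSpace I.tangent v →L[ℝ] ℝ}

theorem NewtonEquation.intermediateNewtonEquation_iff (h : NewtonEquation g D α)
    (hu : SmoothVectorField I u) :
    IntermediateNewtonEquation g α u ↔ ∀ x Y,
      interiorProduct (g.symplecticForm (fieldSection I u x))
        (fieldTangentMap I u x (u x) - D (fieldSection I u x)) (fieldTangentMap I u x Y) = 0 := by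
  refine forall₂_congr fun x Y => ?_
  rw [g.extDerivOneForm_field hu, differential_comp_fieldSection
    (g.contMDiff_kineticEnergy.mdifferentiable (by simp)) hu,
    ← sub_eq_zero (b := (0 : ℝ)), ← h (fieldSection I u x) (fieldTangentMap I u x Y),
    add_sub_add_right_eq_sub, add_sub_add_right_eq_sub, map_sub, sub_apply,
    interiorProduct_apply, interiorProduct_apply]

theorem NewtonEquation.isIntermediateIntegral_iff (h : NewtonEquation g D α)
    (hD : ∀ v, projTangentMap I v (D v) = v.snd) (hu : SmoothVectorField I u) :
    IsIntermediateIntegral I D u ↔ IntermediateNewtonEquation g α u := by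
  rw [ClassicalMechanics.isIntermediateIntegral_iff hD hu, h.intermediateNewtonEquation_iff hu]
  refine forall_congr' fun x => ?_
  have hvertical : projTangentMap I (fieldSection I u x)
      (fieldTangentMap I u x (u x) - D (fieldSection I u x)) = 0 := by
    rw [map_sub, projTangentMap_fieldTangentMap hu, hD]
    exact sub_self _
  rw [← g.eq_zero_iff_forall_interiorProduct_fieldTangentMap hu hvertical, sub_eq_zero]

end IntermediateIntegral

end

end ClassicalMechanics

open ClassicalMechanics in
theorem mainTheorem4_general
    {E : Type*} [NormedAddCommGroup E] [NormedSpace ℝ E] [CompleteSpace E]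
    {H : Type*} [TopologicalSpace H] {I : ModelWithCorners ℝ E H} [I.Boundaryless]
    {M : Type*} [TopologicalSpace M] [ChartedSpace H M] [IsManifold I ∞ M]
    (g : NondegenerateMetric I M) (hg : ∀ x, Function.Surjective (g.toFun x)) :
    (∀ D : Π v : TangentBundle I M, TangentSpace I.tangent v,
      IsSecondOrderEquation I D →
        ∃! α : Π v : TangentBundle I M, TangentSpace I.tangent v →L[ℝ] ℝ,
          IsHorizontalForm I α ∧ NewtonEquation g D α) ∧
    (∀ α : Π v : TangentBundle I M, TangentSpace I.tangent v →L[ℝ] ℝ,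
      IsHorizontalForm I α →
        ∃! D : Π v : TangentBundle I M, TangentSpace I.tangent v,
          IsSecondOrderEquation I D ∧ NewtonEquation g D α) ∧
    (∀ (D : Π v : TangentBundle I M, TangentSpace I.tangent v)
      (α : Π v : TangentBundle I M, TangentSpace I.tangent v →L[ℝ] ℝ),
      IsSecondOrderEquation I D → NewtonEquation g D α →
        ∀ u : Π x : M, TangentSpace I x, SmoothVectorField I u →
          (IsIntermediateIntegral I D u ↔ IntermediateNewtonEquation g α u)) :=
  ⟨fun _ hD => existsUnique_isHorizontalForm_newtonEquation g hD,
    fun _ hα => existsUnique_isSecondOrderEquation_newtonEquation hg hα,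
    fun _ _ hD h _ hu => h.isIntermediateIntegral_iff hD.2 hu⟩

open ClassicalMechanics in
theorem mainTheorem4
    {E : Type*} [NormedAddCommGroup E] [NormedSpace ℝ E] [FiniteDimensional ℝ E]
    {M : Type*} [TopologicalSpace M] [ChartedSpace E M] [IsManifold 𝓘(ℝ, E) ∞ M]
    (g : NondegenerateMetric 𝓘(ℝ, E) M) :
    (∀ D : Π v : TangentBundle 𝓘(ℝ, E) M, TangentSpace 𝓘(ℝ, E).tangent v,
      IsSecondOrderEquation 𝓘(ℝ, E) D →
        ∃! α : Π v : TangentBundle 𝓘(ℝ, E) M, TangentSpace 𝓘(ℝ, E).tangent v →L[ℝ] ℝ,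
          IsHorizontalForm 𝓘(ℝ, E) α ∧ NewtonEquation g D α) ∧
    (∀ α : Π v : TangentBundle 𝓘(ℝ, E) M, TangentSpace 𝓘(ℝ, E).tangent v →L[ℝ] ℝ,
      IsHorizontalForm 𝓘(ℝ, E) α →
        ∃! D : Π v : TangentBundle 𝓘(ℝ, E) M, TangentSpace 𝓘(ℝ, E).tangent v,
          IsSecondOrderEquation 𝓘(ℝ, E) D ∧ NewtonEquation g D α) ∧
    (∀ (D : Π v : TangentBundle 𝓘(ℝ, E) M, TangentSpace 𝓘(ℝ, E).tangent v)
      (α : Π v : TangentBundle 𝓘(ℝ, E) M, TangentSpace 𝓘(ℝ, E).tangent v →L[ℝ] ℝ),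
      IsSecondOrderEquation 𝓘(ℝ, E) D → IsHorizontalForm 𝓘(ℝ, E) α → NewtonEquation g D α →
        ∀ u : Π x : M, TangentSpace 𝓘(ℝ, E) x, SmoothVectorField 𝓘(ℝ, E) u →
          (IsIntermediateIntegral 𝓘(ℝ, E) D u ↔ IntermediateNewtonEquation g α u)) := by
  have := FiniteDimensional.complete ℝ E
  exact (mainTheorem4_general g g.surjective_toFun_of_finiteDimensional).imp_right
    (And.imp_right fun h D α hD _ => h D α hD)
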